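/- Let $\mathcal L$ be a full trio, that is, a family of languages over finite alphabets which is closed under homomorphism, inverse homomorphism and intersection with regular languages, and suppose that $\mathcal L$ is semilinear, that is, the Parikh image of every language in $\mathcal L$ is a semilinear set (a finite union of linear sets $\{v_0+i_1v_1+\cdots+i_nv_n \mid i_1,\dots,i_n\in\mathbb N_0\}$). Let $\mathsf{NCM}$ be the family of all languages accepted by one-way nondeterministic reversal-bounded multicounter machines, that is, nondeterministic finite automata with $\lambda$-moves and finitely many counters (initially zero, holding non-negative integers, which can be incremented, decremented and tested for zero), for which there is a bound $l$ such that in every accepting computation each counter changes at most $l$ times between non-decreasing and non-increasing. Let $\mathcal L\wedge\mathsf{NCM}=\{L_1\cap L_2 \mid L_1\in\mathcal L,\ L_2\in\mathsf{NCM}\}$, and let $\hat{\mathcal F}(\mathcal L\wedge\mathsf{NCM})$ be the smallest full AFL (full trio closed under union, concatenation and Kleene star) containing $\mathcal L\wedge\mathsf{NCM}$. Then $\hat{\mathcal F}(\mathcal L\wedge\mathsf{NCM})$ is semilinear, that is, every language in it has a semilinear Parikh image. -/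

import Mathlib

/-- The Parikh image `ψ(w)` of a word: the vector of the numbers of occurrences of the letters. -/
noncomputable def parikh {α : Type} (w : List α) : α → ℕ :=
  open Classical in fun a => w.count a

/-- A language is semilinear if its Parikh image is a semilinear subset of `ℕ^α`. -/
def SemilinearLanguage {α : Type} (L : Language α) : Prop :=
  IsSemilinearSet {v : α → ℕ | ∃ w ∈ L, parikh w = v}

/-- The homomorphism `α* → β*` of free monoids determined by the images of the letters
(the empty word is allowed as an image). -/
def wordHom {α β : Type} (h : α → List β) (w : List α) : List β := w.flatMap h

/-- The image of a language under a homomorphism. -/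
def homImage {α β : Type} (h : α → List β) (L : Language α) : Language β :=
  {v | ∃ w ∈ L, wordHom h w = v}

/-- The preimage of a language under a homomorphism. -/
def homPreimage {α β : Type} (h : α → List β) (L : Language β) : Language α :=
  {w | wordHom h w ∈ L}

/-- A family of languages: for each finite alphabet, the set of those languages over this
alphabet which belong to the family. -/
def LanguageFamily : Type 1 := (α : Type) → [Finite α] → Set (Language α)

namespace LanguageFamily

/-- Inclusion of families of languages. -/
def Contains (F G : LanguageFamily) : Prop :=
  ∀ (α : Type) [Finite α] (L : Language α), L ∈ G α → L ∈ F α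

/-- A family of languages is semilinear if all its members are. -/
def IsSemilinear (F : LanguageFamily) : Prop :=
  ∀ (α : Type) [Finite α] (L : Language α), L ∈ F α → SemilinearLanguage L

/-- A full trio: a family closed under homomorphism, inverse homomorphism and intersection with
regular languages. -/
structure IsFullTrio (F : LanguageFamily) : Prop where
  hom : ∀ (α β : Type) [Finite α] [Finite β] (h : α → List β) (L : Language α),
    L ∈ F α → homImage h L ∈ F β
  invHom : ∀ (α β : Type) [Finite α] [Finite β] (h : α → List β) (L : Language β),
    L ∈ F β → homPreimage h L ∈ F α
  interRegular : ∀ (α : Type) [Finite α] (L R : Language α),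
    L ∈ F α → R.IsRegular → L ⊓ R ∈ F α

/-- A full AFL: a full trio closed under union, concatenation and Kleene star. Two languages over
different alphabets can be moved to a common alphabet by homomorphisms, so it suffices to speak
about languages over the same alphabet. -/
structure IsFullAFL (F : LanguageFamily) : Prop extends IsFullTrio F where
  union : ∀ (α : Type) [Finite α] (L₁ L₂ : Language α), L₁ ∈ F α → L₂ ∈ F α → L₁ + L₂ ∈ F α
  concat : ∀ (α : Type) [Finite α] (L₁ L₂ : Language α), L₁ ∈ F α → L₂ ∈ F α → L₁ * L₂ ∈ F α
  star : ∀ (α : Type) [Finite α] (L : Language α), L ∈ F α → KStar.kstar L ∈ F α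

/-- The family `F ∧ G` of all intersections `L₁ ∩ L₂` with `L₁ ∈ F` and `L₂ ∈ G`. -/
def meet (F G : LanguageFamily) : LanguageFamily :=
  fun α _ => {L | ∃ L₁ ∈ F α, ∃ L₂ ∈ G α, L = L₁ ⊓ L₂}

/-- The smallest full AFL containing a family, as the intersection of all full AFLs
containing it. -/
def fullAFLClosure (F : LanguageFamily) : LanguageFamily :=
  fun α _ => {L | ∀ G : LanguageFamily, G.IsFullAFL → G.Contains F → L ∈ G α}

theorem fullAFLClosure_contains (F : LanguageFamily) : F.fullAFLClosure.Contains F :=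
  fun α _ L hL _ _ hF => hF α L hL

theorem fullAFLClosure_isFullAFL (F : LanguageFamily) : F.fullAFLClosure.IsFullAFL where
  hom α β _ _ h L hL G hG hF := hG.hom α β h L (hL G hG hF)
  invHom α β _ _ h L hL G hG hF := hG.invHom α β h L (hL G hG hF)
  interRegular α _ L R hL hR G hG hF := hG.interRegular α L R (hL G hG hF) hR
  union α _ L₁ L₂ h₁ h₂ G hG hF := hG.union α L₁ L₂ (h₁ G hG hF) (h₂ G hG hF)
  concat α _ L₁ L₂ h₁ h₂ G hG hF := hG.concat α L₁ L₂ (h₁ G hG hF) (h₂ G hG hF)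
  star α _ L hL G hG hF := hG.star α L (hL G hG hF)

theorem fullAFLClosure_least (F G : LanguageFamily) (hG : G.IsFullAFL) (hF : G.Contains F) :
    G.Contains F.fullAFLClosure :=
  fun _ _ _ hL => hL G hG hF

end LanguageFamily

/-- A one-way nondeterministic machine with `k` counters over the input alphabet `α`.
In a state, reading a letter or nothing (`none`, a λ-move), and knowing of each counter whether
it is nonzero (`true`) or zero (`false`), it may pass to a new state and change each
counter by `-1`, `0` or `1`. -/
structure CounterMachine (α : Type) (k : ℕ) where
  State : Type
  finite_state : Finite State
  trans : State → Option α → (Fin k → Bool) → Set (State × (Fin k → SignType))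
  start : State
  accept : Set State

/-- The number of changes of direction in a sequence of counter changes, if the current direction
is `m` (`1`: non-decreasing, `-1`: non-increasing). Steps which leave the counter unchanged do not
affect the direction. -/
def reversals : SignType → List SignType → ℕ
  | _, [] => 0
  | m, s :: l => if s = 0 ∨ s = m then reversals m l else reversals s l + 1

namespace CounterMachine

variable {α : Type} {k : ℕ}

/-- A configuration (apart from the remaining input): the state and the counter values, which are
natural numbers. -/
abbrev Config (M : CounterMachine α k) : Type := M.State × (Fin k → ℕ)

/-- `M.Step c a d c'`: in configuration `c`, reading `a`, the machine can change its counters by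
`d` and reach `c'`. A zero counter cannot be decreased, as `c'` has values in `ℕ`. -/
def Step (M : CounterMachine α k) (c : M.Config) (a : Option α) (d : Fin k → SignType)
    (c' : M.Config) : Prop :=
  (c'.1, d) ∈ M.trans c.1 a (fun i => decide (c.2 i ≠ 0)) ∧
    ∀ i, (c'.2 i : ℤ) = (c.2 i : ℤ) + (d i : ℤ)

/-- `M.Run c w ds c'`: there is a computation from `c` to `c'` that reads the word `w` and whose
steps change the counters by the successive members of the list `ds`. -/
inductive Run (M : CounterMachine α k) :
    M.Config → List α → List (Fin k → SignType) → M.Config → Prop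
  | nil (c : M.Config) : Run M c [] [] c
  | cons {c c' c'' : M.Config} {a : Option α} {d : Fin k → SignType} {w : List α}
      {ds : List (Fin k → SignType)} :
      M.Step c a d c' → Run M c' w ds c'' → Run M c (a.toList ++ w) (d :: ds) c''

/-- There is an accepting computation on `w` with counter changes `ds`: it starts in the start
state with all counters zero, reads all of `w`, and ends in an accepting state. -/
def AcceptingRun (M : CounterMachine α k) (w : List α) (ds : List (Fin k → SignType)) : Prop :=
  ∃ c : M.Config, c.1 ∈ M.accept ∧ M.Run (M.start, fun _ => 0) w ds c

/-- The language accepted by the machine. -/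
def accepts (M : CounterMachine α k) : Language α := {w | ∃ ds, M.AcceptingRun w ds}

/-- The machine is `l`-reversal-bounded: in every accepting computation, each counter changes
at most `l` times between non-decreasing and non-increasing. -/
def IsReversalBounded (M : CounterMachine α k) (l : ℕ) : Prop :=
  ∀ w ds, M.AcceptingRun w ds → ∀ i, reversals 1 (ds.map fun d => d i) ≤ l

end CounterMachine

/-- The family of the languages accepted by one-way nondeterministic `l`-reversal-bounded
`k`-counter machines, for some `k` and `l`. -/
def NCM : LanguageFamily :=
  fun α _ => {L | ∃ (k l : ℕ) (M : CounterMachine α k), M.IsReversalBounded l ∧ M.accepts = L}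

open scoped Pointwise

/-! The proof exhibits one semilinear full AFL that contains all the intersections. Call a language
robust if every finite automaton whose edges carry semilinear sets of outputs, in a finitely
generated commutative monoid, produces a semilinear set of total outputs over the words of the
language (`RobustlySemilinear`). Outputting unit vectors gives the Parikh image, so robust languages
are semilinear.

Robust languages form a full AFL because each operation can be absorbed into the automaton:
homomorphisms compose paths, inverse homomorphisms need a bounded buffer, and concatenation and star
become the product and the star of matrices of semilinear sets. Outputs in a product monoid also
allow intersection with any language given by a semilinear condition on a second output
(`inter_pathWeight`).

Members of a semilinear full trio are robust: decorate each word with the edges of a path, take the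
Parikh image, and substitute the output sets for the edges.

For a counter machine, computations are words over its transitions. State consistency is regular. A
reversal-bounded counter passes through boundedly many stages of constant direction and zero status,
so its correctness is a semilinear condition on the outputs of a finite automaton that guesses the
values at the stage changes. A homomorphism then recovers the input. -/

theorem IsSemilinearSet.const_and {A : Type*} [AddCommMonoid A] (P : Prop) {s : Set A}
    (hs : IsSemilinearSet s) : IsSemilinearSet {v | P ∧ v ∈ s} := by
  by_cases h : P <;> simp [h, hs]

/-! ### Automata with sets of outputs -/

section PathWeight

variable {α β Q A : Type} [AddCommMonoid A]

/-- The weights of the paths labelled by a word in an automaton with set-valued weights: the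
entries of the product of the matrices assigned to the letters of the word. -/
def pathWeight (M : α → Q → Q → Set A) : List α → Q → Q → Set A
  | [], p, q => {v | p = q ∧ v = 0}
  | a :: w, p, q => ⋃ r, M a p r + pathWeight M w r q

theorem mem_pathWeight_nil {M : α → Q → Q → Set A} {p q : Q} {v : A} :
    v ∈ pathWeight M [] p q ↔ p = q ∧ v = 0 := Iff.rfl

theorem mem_pathWeight_cons {M : α → Q → Q → Set A} {a : α} {w : List α} {p q : Q} {v : A} :
    v ∈ pathWeight M (a :: w) p q ↔
      ∃ r, ∃ x ∈ M a p r, ∃ y ∈ pathWeight M w r q, x + y = v := by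
  simp [pathWeight, Set.mem_add]

theorem mem_pathWeight_append {M : α → Q → Q → Set A} {u w : List α} {p q : Q} {v : A} :
    v ∈ pathWeight M (u ++ w) p q ↔
      ∃ r, ∃ x ∈ pathWeight M u p r, ∃ y ∈ pathWeight M w r q, x + y = v := by
  induction u generalizing p v with
  | nil => simp [mem_pathWeight_nil]
  | cons a u ih =>
    simp only [List.cons_append, mem_pathWeight_cons, ih]
    constructor
    · rintro ⟨r, x, hx, _, ⟨t, y, hy, z, hz, rfl⟩, rfl⟩
      exact ⟨t, x + y, ⟨r, x, hx, y, hy, rfl⟩, z, hz, add_assoc _ _ _⟩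
    · rintro ⟨t, _, ⟨r, x, hx, y, hy, rfl⟩, z, hz, rfl⟩
      exact ⟨r, x, hx, y + z, ⟨t, y, hy, z, hz, rfl⟩, (add_assoc _ _ _).symm⟩

/-- Reading an image word is the same as composing the steps of each `h a` into a single step; this
makes robustness stable under homomorphism. -/
theorem pathWeight_wordHom (M : β → Q → Q → Set A) (h : α → List β) (w : List α) (p q : Q) :
    pathWeight M (wordHom h w) p q = pathWeight (fun a => pathWeight M (h a)) w p q := by
  induction w generalizing p with
  | nil => rfl
  | cons a w ih =>
    ext v
    simp only [wordHom, List.flatMap_cons, mem_pathWeight_append, mem_pathWeight_cons]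
    simp only [← ih, wordHom]

theorem pathWeight_map (M : β → Q → Q → Set A) (f : α → β) (w : List α) (p q : Q) :
    pathWeight M (w.map f) p q = pathWeight (fun a => M (f a)) w p q := by
  induction w generalizing p with
  | nil => rfl
  | cons a w ih => simp only [List.map_cons, pathWeight, ih]

theorem IsSemilinearSet.pathWeight [Finite Q] {M : α → Q → Q → Set A}
    (hM : ∀ a p q, IsSemilinearSet (M a p q)) (w : List α) (p q : Q) :
    IsSemilinearSet (pathWeight M w p q) := by
  induction w generalizing p with
  | nil => exact (IsSemilinearSet.singleton 0).const_and (p = q)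
  | cons a w ih => exact .iUnion fun r => (hM a p r).add (ih r)

/-- The weights of the nonempty paths all of whose inner states belong to `S`. -/
inductive PathThrough (B : Q → Q → Set A) (S : Set Q) : Q → Q → A → Prop
  | edge {p q : Q} {v : A} : v ∈ B p q → PathThrough B S p q v
  | cons {p r q : Q} {x y : A} :
      x ∈ B p r → r ∈ S → PathThrough B S r q y → PathThrough B S p q (x + y)

theorem PathThrough.mono {B : Q → Q → Set A} {S T : Set Q} (hST : S ⊆ T) {p q : Q} {v : A}
    (h : PathThrough B S p q v) : PathThrough B T p q v := by
  induction h with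
  | edge h => exact .edge h
  | cons hx hr _ ih => exact .cons hx (hST hr) ih

theorem PathThrough.trans {B : Q → Q → Set A} {S : Set Q} {p r q : Q} {x y : A}
    (h₁ : PathThrough B S p r x) (hr : r ∈ S) (h₂ : PathThrough B S r q y) :
    PathThrough B S p q (x + y) := by
  induction h₁ with
  | edge h => exact .cons h hr h₂
  | cons hx ht _ ih => rw [add_assoc]; exact .cons hx ht (ih hr h₂)

/-- Kleene's recursion: cut a path at its visits to `r`. Since outputs commute, the loops at `r`
contribute a generated submonoid, and this keeps the sets semilinear. -/
theorem pathThrough_insert (B : Q → Q → Set A) (S : Set Q) (r p q : Q) :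
    {v | PathThrough B (insert r S) p q v} =
      {v | PathThrough B S p q v} ∪ ({v | PathThrough B S p r v} +
        (AddSubmonoid.closure {v | PathThrough B S r r v} : Set A) +
          {v | PathThrough B S r q v}) := by
  ext v
  constructor
  · intro h
    induction h with
    | edge h => exact .inl (.edge h)
    | @cons p t q x y hx ht _ ih =>
      rcases ht with rfl | ht
      · right
        rcases ih with ih | ⟨_, ⟨a, ha, c, hc, rfl⟩, b, hb, rfl⟩
        · exact ⟨x + 0, ⟨x, .edge hx, 0, zero_mem _, rfl⟩, y, ih, by simp⟩
        · exact ⟨x + (a + c), ⟨x, .edge hx, a + c,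
            add_mem (AddSubmonoid.subset_closure ha) hc, rfl⟩, b, hb, by simp [add_assoc]⟩
      · rcases ih with ih | ⟨_, ⟨a, ha, c, hc, rfl⟩, b, hb, rfl⟩
        · exact .inl (.cons hx ht ih)
        · exact .inr ⟨x + a + c, ⟨x + a, .cons hx ht ha, c, hc, rfl⟩, b, hb,
            by simp [add_assoc]⟩
  · have hS : S ⊆ insert r S := Set.subset_insert r S
    have hr : r ∈ insert r S := Set.mem_insert r S
    rintro (h | ⟨_, ⟨a, ha, c, hc, rfl⟩, b, hb, rfl⟩)
    · exact h.mono hS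
    -- The tail `b` is arbitrary, so that the loops at `r` can be prepended one after another.
    · have key : ∀ b, PathThrough B (insert r S) r q b →
          PathThrough B (insert r S) r q (c + b) := by
        induction hc using AddSubmonoid.closure_induction with
        | mem x hx => exact fun b hb => (PathThrough.mono hS hx).trans hr hb
        | zero => simp
        | add x y _ _ ihx ihy =>
          intro b hb
          rw [add_assoc]
          exact ihx _ (ihy _ hb)
      simpa [add_assoc] using (PathThrough.mono hS ha).trans hr (key b (PathThrough.mono hS hb))

theorem isSemilinearSet_pathThrough [Finite Q] {B : Q → Q → Set A}
    (hB : ∀ p q, IsSemilinearSet (B p q)) (S : Set Q) (p q : Q) :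
    IsSemilinearSet {v | PathThrough B S p q v} := by
  induction S, S.toFinite using Set.Finite.induction_on generalizing p q with
  | empty =>
    convert hB p q using 1
    ext v
    refine ⟨fun h => ?_, .edge⟩
    cases h with
    | edge h => exact h
    | cons _ hr _ => exact hr.elim
  | insert _ _ ih =>
    rw [pathThrough_insert]
    exact (ih p q).union (((ih p _).add (ih _ _).closure).add (ih _ q))

/-- The entries of the Kleene star of a matrix of sets. -/
inductive StarWeight (B : Q → Q → Set A) : Q → Q → A → Prop
  | refl (p : Q) : StarWeight B p p 0
  | cons {p r q : Q} {x y : A} : x ∈ B p r → StarWeight B r q y → StarWeight B p q (x + y)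

theorem isSemilinearSet_starWeight [Finite Q] {B : Q → Q → Set A}
    (hB : ∀ p q, IsSemilinearSet (B p q)) (p q : Q) :
    IsSemilinearSet {v | StarWeight B p q v} := by
  convert ((IsSemilinearSet.singleton 0).const_and (p = q)).union
    (isSemilinearSet_pathThrough hB Set.univ p q) using 1
  ext v
  constructor
  · intro h
    induction h with
    | refl p => exact .inl ⟨rfl, rfl⟩
    | cons hx _ ih =>
      rcases ih with ⟨rfl, rfl⟩ | ih
      · exact .inr (by rw [add_zero]; exact .edge hx)
      · exact .inr (.cons hx trivial ih)
  · rintro (⟨rfl, rfl⟩ | h)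
    · exact .refl p
    · induction h with
      | edge h => simpa using StarWeight.cons h (.refl _)
      | cons hx _ _ ih => exact .cons hx ih

end PathWeight

/-! ### Products and substitution for semilinear sets -/

theorem IsSemilinearSet.prod {A B : Type*} [AddCommMonoid A] [AddCommMonoid B] {s : Set A}
    {t : Set B} (hs : IsSemilinearSet s) (ht : IsSemilinearSet t) : IsSemilinearSet (s ×ˢ t) := by
  convert (hs.image (AddMonoidHom.inl A B)).add (ht.image (AddMonoidHom.inr A B)) using 1
  ext ⟨a, b⟩
  simp [Set.mem_add]

/-- The semilinear sets form a submonoid with respect to the sum of sets. -/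
def semilinearSets (A : Type*) [AddCommMonoid A] : AddSubmonoid (Set A) where
  carrier := {s | IsSemilinearSet s}
  zero_mem' := IsSemilinearSet.singleton 0
  add_mem' := IsSemilinearSet.add

/-- Substituting semilinear sets for the generators turns a semilinear set into a semilinear
set. -/
theorem IsSemilinearSet.biUnion_addMonoidHom {N A : Type*} [AddCommMonoid N] [AddCommMonoid A]
    {S : Set N} (hS : IsSemilinearSet S) (f : N →+ Set A) (hf : ∀ u, IsSemilinearSet (f u)) :
    IsSemilinearSet (⋃ u ∈ S, f u) := by
  obtain ⟨𝒮, h𝒮, hlin, rfl⟩ := hS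
  rw [show ⋃ u ∈ ⋃₀ 𝒮, f u = ⋃ s ∈ 𝒮, ⋃ u ∈ s, f u by ext; simp]
  refine .biUnion h𝒮 fun s hs => ?_
  obtain ⟨a, t, ht, rfl⟩ := hlin s hs
  -- Since `f` is additive, the linear set with base `a` and periods `t` yields `f a` plus the
  -- submonoid generated by all the `f u` with `u ∈ t`.
  convert (hf a).add (IsSemilinearSet.biUnion ht fun u _ => hf u).closure using 1
  ext v
  simp only [Set.mem_iUnion, Set.mem_add, Set.mem_vadd_set, vadd_eq_add, SetLike.mem_coe,
    exists_prop]
  constructor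
  · rintro ⟨_, ⟨u, hu, rfl⟩, hv⟩
    rw [map_add] at hv
    obtain ⟨x, hx, y, hy, rfl⟩ := hv
    refine ⟨x, hx, y, ?_, rfl⟩
    clear hx
    induction hu using AddSubmonoid.closure_induction generalizing y with
    | mem u hu => exact AddSubmonoid.subset_closure (Set.mem_biUnion hu hy)
    | zero =>
      rw [map_zero] at hy
      rw [Set.mem_zero.1 hy]
      exact zero_mem _
    | add u u' _ _ ih ih' =>
      rw [map_add] at hy
      obtain ⟨y, hy, y', hy', rfl⟩ := hy
      exact add_mem (ih _ hy) (ih' _ hy')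
  · rintro ⟨x, hx, y, hy, rfl⟩
    suffices ∃ u ∈ AddSubmonoid.closure t, y ∈ f u by
      obtain ⟨u, hu, hy⟩ := this
      exact ⟨_, ⟨u, hu, rfl⟩, by rw [map_add]; exact Set.add_mem_add hx hy⟩
    clear hx
    induction hy using AddSubmonoid.closure_induction with
    | mem y hy =>
      obtain ⟨u, hu, hy⟩ := Set.mem_iUnion₂.1 hy
      exact ⟨u, AddSubmonoid.subset_closure hu, hy⟩
    | zero => exact ⟨0, zero_mem _, by rw [map_zero]; exact Set.zero_mem_zero⟩
    | add y y' _ _ ih ih' =>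
      obtain ⟨u, hu, hy⟩ := ih
      obtain ⟨u', hu', hy'⟩ := ih'
      exact ⟨u + u', add_mem hu hu', by rw [map_add]; exact Set.add_mem_add hy hy'⟩

/-! ### Parikh vectors, erased words and path languages -/

section Parikh

variable {α : Type}

theorem parikh_nil : parikh ([] : List α) = 0 := by
  ext a; simp [parikh]

theorem parikh_cons [DecidableEq α] (a : α) (w : List α) : parikh (a :: w) = Pi.single a 1 + parikh w := by
  ext b
  by_cases h : a = b
  · subst h; simp [parikh, add_comm]
  · simp [parikh, h, Ne.symm h]

end Parikh

theorem wordHom_eq_cons {α β : Type} {h : α → List β} {w : List α} {b : β} {v : List β}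
    (hw : wordHom h w = b :: v) : ∃ w₀ a w₁ t, w = w₀ ++ a :: w₁ ∧ wordHom h w₀ = [] ∧
      h a = b :: t ∧ t ++ wordHom h w₁ = v := by
  induction w with
  | nil => simp [wordHom] at hw
  | cons a w ih =>
    cases ha : h a with
    | nil =>
      obtain ⟨w₀, a', w₁, t, rfl, h₀, h₁, h₂⟩ := ih (by simpa [wordHom, ha] using hw)
      exact ⟨a :: w₀, a', w₁, t, rfl, by simpa [wordHom, ha] using h₀, h₁, h₂⟩
    | cons c t =>
      have : c = b ∧ t ++ wordHom h w = v := by simpa [wordHom, ha] using hw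
      exact ⟨[], a, w, t, rfl, rfl, this.1 ▸ ha, this.2⟩

/-- A word is erased exactly when all its letters are, so this is an entry of the star of the matrix
obtained by summing over the erased letters. -/
theorem isSemilinearSet_pathWeight_erased {α β Q A : Type} [Finite α] [Finite Q] [AddCommMonoid A]
    {M : α → Q → Q → Set A} (hM : ∀ a p q, IsSemilinearSet (M a p q)) (h : α → List β) (p q : Q) :
    IsSemilinearSet {v | ∃ w, wordHom h w = [] ∧ v ∈ pathWeight M w p q} := by
  have hB (p q : Q) : IsSemilinearSet (⋃ a, {v | h a = [] ∧ v ∈ M a p q}) :=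
    .iUnion fun a => (hM a p q).const_and _
  convert isSemilinearSet_starWeight hB p q using 1
  ext v
  constructor
  · rintro ⟨w, hw, hv⟩
    induction w generalizing p v with
    | nil =>
      obtain ⟨rfl, rfl⟩ := hv
      exact .refl _
    | cons a w ih =>
      obtain ⟨r, x, hx, y, hy, rfl⟩ := mem_pathWeight_cons.1 hv
      obtain ⟨ha, hw⟩ : h a = [] ∧ wordHom h w = [] := by
        simpa only [wordHom, List.flatMap_cons, List.append_eq_nil_iff] using hw
      exact .cons (Set.mem_iUnion.2 ⟨a, ha, hx⟩) (ih r _ hw hy)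
  · intro hv
    induction hv with
    | refl p => exact ⟨[], rfl, rfl, rfl⟩
    | cons hx _ ih =>
      obtain ⟨a, ha, hx⟩ := Set.mem_iUnion.1 hx
      obtain ⟨w, hw, hv⟩ := ih
      refine ⟨a :: w, ?_, mem_pathWeight_cons.2 ⟨_, _, hx, _, hv, rfl⟩⟩
      simpa [wordHom, ha] using hw

/-- `IsPath step w p q`: the word `w` labels a path from `p` to `q` in the graph with the labelled
edges `step`. -/
def IsPath {α Q : Type} (step : α → Q → Q → Prop) : List α → Q → Q → Prop
  | [], p, q => p = q
  | a :: w, p, q => ∃ r, step a p r ∧ IsPath step w r q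

theorem isRegular_isPath {α Q : Type} [Finite Q] (step : α → Q → Q → Prop) (p : Q) (F : Set Q) :
    Language.IsRegular ({w | ∃ q ∈ F, IsPath step w p q} : Language α) := by
  classical
  have := Fintype.ofFinite Q
  let N : NFA α Q := ⟨fun s a => {t | step a s t}, {p}, F⟩
  refine ⟨Set Q, inferInstance, N.toDFA, ?_⟩
  rw [NFA.toDFA_correct]
  have key (w : List α) : ∀ p q, q ∈ N.evalFrom {p} w ↔ IsPath step w p q := by
    induction w with
    | nil => intro p q; simp [IsPath, eq_comm]
    | cons a w ih =>
      intro p q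
      rw [NFA.evalFrom_cons, NFA.stepSet_singleton, NFA.mem_evalFrom_iff_exists]
      simp only [ih, IsPath]
      rfl
  ext w
  rw [NFA.mem_accepts]
  exact exists_congr fun q => and_congr_right fun _ => key w p q

/-- The languages all of whose images under finite transducers with semilinear output sets are
semilinear. -/
def RobustlySemilinear : LanguageFamily := fun α _ =>
  {L | ∀ (Q A : Type) [Finite Q] [AddCommMonoid A] [AddMonoid.FG A] (M : α → Q → Q → Set A),
    (∀ a p q, IsSemilinearSet (M a p q)) → ∀ p q,
      IsSemilinearSet {v | ∃ w ∈ L, v ∈ pathWeight M w p q}}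

/-! ### Semilinear full trios are robust -/

namespace LanguageFamily

/-- The total output along a path depends only on how often each edge is used. The edge words of
paths labelled by `L` form a language of the trio, so their Parikh image is semilinear. -/
theorem IsFullTrio.robustlySemilinear_contains {F : LanguageFamily} (hF : F.IsFullTrio)
    (hSemi : F.IsSemilinear) : RobustlySemilinear.Contains F := by
  intro α _ L hL Q A _ _ _ M hM p₀ q₀
  classical
  have := Fintype.ofFinite α
  have := Fintype.ofFinite Q
  let E := Q × α × Q
  let label : E → List α := fun e => [e.2.1]
  let step : E → Q → Q → Prop := fun e p q => e.1 = p ∧ e.2.2 = q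
  -- `f u` is the Minkowski sum in which the output set of each edge `e` is taken `u e` times.
  let f : (E → ℕ) →+ Set A :=
    ∑ e : E, (multiplesHom (Set A) (M e.2.1 e.1 e.2.2)).comp (Pi.evalAddMonoidHom (fun _ => ℕ) e)
  have hf (u : E → ℕ) : IsSemilinearSet (f u) := by
    suffices f u ∈ semilinearSets A from this
    rw [AddMonoidHom.finsetSum_apply]
    refine sum_mem fun e _ => ?_
    simp only [AddMonoidHom.comp_apply, multiplesHom_apply]
    exact nsmul_mem (show M e.2.1 e.1 e.2.2 ∈ semilinearSets A from hM _ _ _) _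
  have hf1 (e : E) : f (Pi.single e 1) = M e.2.1 e.1 e.2.2 := by
    rw [AddMonoidHom.finsetSum_apply, Finset.sum_eq_single e]
    · simp
    · intro e' _ he
      simp [Pi.single_eq_of_ne he]
    · simp
  have key (w : List α) : ∀ p q v, v ∈ pathWeight M w p q ↔
      ∃ γ : List E, wordHom label γ = w ∧ IsPath step γ p q ∧ v ∈ f (parikh γ) := by
    induction w with
    | nil =>
      intro p q v
      constructor
      · rintro ⟨rfl, rfl⟩
        exact ⟨[], rfl, rfl, by rw [parikh_nil, map_zero]; exact Set.zero_mem_zero⟩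
      · rintro ⟨γ, hγ, hp, hv⟩
        cases γ with
        | nil =>
          rw [parikh_nil, map_zero] at hv
          exact ⟨hp, hv⟩
        | cons e γ => simp [wordHom, label] at hγ
    | cons a w ih =>
      intro p q v
      rw [mem_pathWeight_cons]
      constructor
      · rintro ⟨r, x, hx, y, hy, rfl⟩
        obtain ⟨γ, hγ, hp, hv⟩ := (ih _ _ _).1 hy
        refine ⟨(p, a, r) :: γ, ?_, ⟨r, ⟨rfl, rfl⟩, hp⟩, ?_⟩
        · rw [← hγ]; rfl
        · rw [parikh_cons, map_add, hf1]
          exact Set.add_mem_add hx hv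
      · rintro ⟨γ, hγ, hp, hv⟩
        cases γ with
        | nil => simp [wordHom] at hγ
        | cons e γ =>
          obtain ⟨p', b, r'⟩ := e
          obtain ⟨r, ⟨rfl, rfl⟩, hp⟩ := hp
          rw [parikh_cons, map_add, hf1] at hv
          obtain ⟨x, hx, y, hy, rfl⟩ := hv
          simp only [wordHom, label, List.flatMap_cons, List.cons_append, List.nil_append,
            List.cons.injEq] at hγ
          obtain ⟨rfl, hγ⟩ := hγ
          exact ⟨_, x, hx, y, (ih _ _ _).2 ⟨γ, hγ, hp, hy⟩, rfl⟩
  have hK := hSemi _ _ (hF.interRegular E _ _ (hF.invHom E α label L hL)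
    (isRegular_isPath step p₀ {q₀}))
  convert hK.biUnion_addMonoidHom f hf using 1
  ext v
  simp only [key, Set.mem_iUnion, exists_prop]
  constructor
  · rintro ⟨w, hw, γ, rfl, hp, hv⟩
    exact ⟨_, ⟨γ, ⟨hw, q₀, rfl, hp⟩, rfl⟩, hv⟩
  · rintro ⟨_, ⟨γ, ⟨hw, _, rfl, hp⟩, rfl⟩, hv⟩
    exact ⟨_, hw, γ, rfl, hp, hv⟩

end LanguageFamily

/-! ### Closure properties of robust languages -/

namespace RobustlySemilinear

variable {α β : Type} [Finite α] [Finite β]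

theorem isSemilinear : RobustlySemilinear.IsSemilinear := by
  classical
  intro α _ L hL
  have key (w : List α) : pathWeight (fun (a : α) (_ _ : Unit) => {(Pi.single a 1 : α → ℕ)}) w
      () () = {parikh w} := by
    induction w with
    | nil => ext v; simp [mem_pathWeight_nil, parikh_nil]
    | cons a w ih =>
      ext v
      simp [mem_pathWeight_cons, ih, parikh_cons, eq_comm]
  have := hL Unit (α → ℕ) _ (fun a _ _ => IsSemilinearSet.singleton (Pi.single a 1)) () ()
  simp only [key, Set.mem_singleton_iff] at this
  simpa only [SemilinearLanguage, eq_comm] using this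

theorem hom (h : α → List β) {L : Language α} (hL : L ∈ RobustlySemilinear α) :
    homImage h L ∈ RobustlySemilinear β := by
  intro Q A _ _ _ M hM p q
  convert hL Q A _ (fun a => IsSemilinearSet.pathWeight hM (h a)) p q using 1
  ext v
  simp only [← pathWeight_wordHom]
  exact ⟨fun ⟨_, ⟨w, hw, rfl⟩, hv⟩ => ⟨w, hw, hv⟩, fun ⟨w, hw, hv⟩ => ⟨_, ⟨w, hw, rfl⟩, hv⟩⟩

/-- Intersection with a language defined by a semilinear condition on the output of a finite
transducer. -/
theorem inter_pathWeight {S B : Type} [Finite S] [AddCommMonoid B] [AddMonoid.FG B]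
    {δ : α → S → S → Set B} (hδ : ∀ a s t, IsSemilinearSet (δ a s t)) (s₀ : S) {C : S → Set B}
    (hC : ∀ t, IsSemilinearSet (C t)) {L : Language α} (hL : L ∈ RobustlySemilinear α) :
    L ⊓ {w | ∃ t, ∃ c ∈ C t, c ∈ pathWeight δ w s₀ t} ∈ RobustlySemilinear α := by
  intro Q A _ _ _ M hM p q
  -- Both automata run in parallel; the condition `C` is then imposed on the second output, which is
  -- projected away.
  let P : α → Q × S → Q × S → Set (A × B) := fun a x y => M a x.1 y.1 ×ˢ δ a x.2 y.2
  have key (w : List α) : ∀ p s q t,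
      pathWeight P w (p, s) (q, t) = pathWeight M w p q ×ˢ pathWeight δ w s t := by
    induction w with
    | nil =>
      intro p s q t
      ext ⟨a, b⟩
      simp only [mem_pathWeight_nil, Set.mem_prod, Prod.mk.injEq, Prod.mk_eq_zero]
      tauto
    | cons a w ih =>
      intro p s q t
      ext ⟨x, y⟩
      simp only [mem_pathWeight_cons, Set.mem_prod, Prod.exists, ih, P]
      constructor
      · rintro ⟨p', s', x₁, y₁, ⟨hx₁, hy₁⟩, x₂, y₂, ⟨hx₂, hy₂⟩, h⟩
        obtain ⟨rfl, rfl⟩ := Prod.mk.inj h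
        exact ⟨⟨p', x₁, hx₁, x₂, hx₂, rfl⟩, s', y₁, hy₁, y₂, hy₂, rfl⟩
      · rintro ⟨⟨p', x₁, hx₁, x₂, hx₂, rfl⟩, s', y₁, hy₁, y₂, hy₂, rfl⟩
        exact ⟨p', s', x₁, y₁, ⟨hx₁, hy₁⟩, x₂, y₂, ⟨hx₂, hy₂⟩, rfl⟩
  have hP := hL (Q × S) (A × B) P (fun a x y => (hM a x.1 y.1).prod (hδ a x.2 y.2)) (p, s₀)
  convert IsSemilinearSet.iUnion fun t =>
    ((hP (q, t)).inter ((hC t).preimage (AddMonoidHom.snd A B))).image (AddMonoidHom.fst A B)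
    using 1
  ext v
  simp only [key, Set.mem_iUnion, Set.mem_image, Set.mem_inter_iff, Set.mem_preimage,
    AddMonoidHom.coe_snd, AddMonoidHom.coe_fst]
  constructor
  · rintro ⟨w, ⟨hw, t, c, hc, hcw⟩, hv⟩
    exact ⟨t, (v, c), ⟨⟨w, hw, hv, hcw⟩, hc⟩, rfl⟩
  · rintro ⟨t, ⟨v, c⟩, ⟨⟨w, hw, hv, hcw⟩, hc⟩, rfl⟩
    exact ⟨w, ⟨hw, t, c, hc, hcw⟩, hv⟩

/-- A deterministic automaton is a transducer with only the output `0`; acceptance is a condition on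
its final state. -/
theorem interRegular {L R : Language α} (hL : L ∈ RobustlySemilinear α) (hR : R.IsRegular) :
    L ⊓ R ∈ RobustlySemilinear α := by
  obtain ⟨S, _, D, rfl⟩ := hR
  have key (w : List α) : ∀ s t, pathWeight (A := ℕ)
      (fun a s t => {z | D.step s a = t ∧ z ∈ ({0} : Set ℕ)}) w s t =
        {z | D.evalFrom s w = t ∧ z = 0} := by
    induction w with
    | nil => intro s t; rfl
    | cons a w ih =>
      intro s t
      ext z
      simp only [mem_pathWeight_cons, ih, DFA.evalFrom_cons]
      constructor
      · rintro ⟨r, x, ⟨rfl, rfl⟩, y, ⟨rfl, rfl⟩, rfl⟩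
        exact ⟨rfl, rfl⟩
      · rintro ⟨rfl, rfl⟩
        exact ⟨_, 0, ⟨rfl, rfl⟩, 0, ⟨rfl, rfl⟩, rfl⟩
  convert inter_pathWeight (fun a s t => (IsSemilinearSet.singleton (0 : ℕ)).const_and
    (D.step s a = t)) D.start (C := fun t => {z | t ∈ D.accept ∧ z ∈ ({0} : Set ℕ)})
    (fun t => (IsSemilinearSet.singleton 0).const_and (t ∈ D.accept)) hL using 1
  ext w
  refine and_congr_right fun _ => ⟨fun h => ⟨_, 0, ⟨h, rfl⟩, ?_⟩, ?_⟩
  · exact (key w _ _).symm ▸ ⟨rfl, rfl⟩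
  · rintro ⟨_, _, ⟨h, -⟩, hw⟩
    rw [key] at hw
    obtain ⟨rfl, -⟩ := hw
    exact h

theorem union {L₁ L₂ : Language α} (h₁ : L₁ ∈ RobustlySemilinear α)
    (h₂ : L₂ ∈ RobustlySemilinear α) : L₁ + L₂ ∈ RobustlySemilinear α := by
  intro Q A _ _ _ M hM p q
  convert (h₁ Q A M hM p q).union (h₂ Q A M hM p q) using 1
  ext v
  constructor
  · rintro ⟨w, hw | hw, hv⟩
    exacts [.inl ⟨w, hw, hv⟩, .inr ⟨w, hw, hv⟩]
  · rintro (⟨w, hw, hv⟩ | ⟨w, hw, hv⟩)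
    exacts [⟨w, .inl hw, hv⟩, ⟨w, .inr hw, hv⟩]

theorem concat {L₁ L₂ : Language α} (h₁ : L₁ ∈ RobustlySemilinear α)
    (h₂ : L₂ ∈ RobustlySemilinear α) : L₁ * L₂ ∈ RobustlySemilinear α := by
  intro Q A _ _ _ M hM p q
  convert IsSemilinearSet.iUnion fun r => (h₁ Q A M hM p r).add (h₂ Q A M hM r q) using 1
  ext v
  simp only [Set.mem_iUnion, Set.mem_add]
  constructor
  · rintro ⟨w, hw, hv⟩
    obtain ⟨w₁, hw₁, w₂, hw₂, rfl⟩ := Language.mem_mul.1 hw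
    obtain ⟨r, x, hx, y, hy, rfl⟩ := mem_pathWeight_append.1 hv
    exact ⟨r, x, ⟨w₁, hw₁, hx⟩, y, ⟨w₂, hw₂, hy⟩, rfl⟩
  · rintro ⟨r, x, ⟨w₁, hw₁, hx⟩, y, ⟨w₂, hw₂, hy⟩, rfl⟩
    exact ⟨w₁ ++ w₂, Language.mem_mul.2 ⟨w₁, hw₁, w₂, hw₂, rfl⟩,
      mem_pathWeight_append.2 ⟨r, x, hx, y, hy, rfl⟩⟩

/-- Cutting a path at the borders of the factors gives the star of the matrix of total outputs over
`L`. -/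
theorem star {L : Language α} (hL : L ∈ RobustlySemilinear α) :
    KStar.kstar L ∈ RobustlySemilinear α := by
  intro Q A _ _ _ M hM p q
  convert isSemilinearSet_starWeight (fun p q => hL Q A M hM p q) p q using 1
  ext v
  constructor
  · rintro ⟨w, hw, hv⟩
    obtain ⟨S, rfl, hS⟩ := Language.mem_kstar.1 hw
    clear hw
    induction S generalizing p v with
    | nil =>
      obtain ⟨rfl, rfl⟩ := hv
      exact .refl _
    | cons u S ih =>
      rw [List.flatten_cons] at hv
      obtain ⟨r, x, hx, y, hy, rfl⟩ := mem_pathWeight_append.1 hv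
      exact .cons ⟨u, hS u (by simp), hx⟩ (ih r _ (fun u hu => hS u (by simp [hu])) hy)
  · intro h
    induction h with
    | refl p => exact ⟨[], Language.nil_mem_kstar L, rfl, rfl⟩
    | cons hx _ ih =>
      obtain ⟨u, hu, hx⟩ := hx
      obtain ⟨w, hw, hv⟩ := ih
      refine ⟨u ++ w, ?_, mem_pathWeight_append.2 ⟨_, _, hx, _, hv, rfl⟩⟩
      obtain ⟨S, rfl, hS⟩ := Language.mem_kstar.1 hw
      exact Language.mem_kstar.2 ⟨u :: S, rfl, by simpa using ⟨hu, hS⟩⟩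

/-- The new automaton reads the image and guesses the preimage letter by letter. Erased letters
leave no trace in the image; their outputs are collected in the semilinear sets `N`. -/
theorem invHom (h : α → List β) {L : Language β} (hL : L ∈ RobustlySemilinear β) :
    homPreimage h L ∈ RobustlySemilinear α := by
  intro Q A _ _ _ M hM p₀ q₀
  obtain ⟨n, hn⟩ : ∃ n, ∀ a, (h a).length ≤ n := by
    obtain ⟨n, hn⟩ := (Set.finite_range fun a => (h a).length).bddAbove
    exact ⟨n, fun a => hn ⟨a, rfl⟩⟩
  -- A state also holds the part of the image of the last letter which is still to be read.
  let Buffer := {l : List β // l.length ≤ n}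
  have : Finite Buffer := (List.finite_length_le β n).to_subtype
  let N : Q → Q → Set A := fun p q => {v | ∃ w, wordHom h w = [] ∧ v ∈ pathWeight M w p q}
  have hN : ∀ p q, IsSemilinearSet (N p q) := isSemilinearSet_pathWeight_erased hM h
  -- A letter is either taken from the buffer at no cost, or, with the buffer empty, begins the
  -- image of a guessed letter `a` preceded by an erased word.
  let M' : β → Q × Buffer → Q × Buffer → Set A := fun b x y =>
    {v | (x.2.1 = b :: y.2.1 ∧ x.1 = y.1) ∧ v ∈ ({0} : Set A)} ∪
      ⋃ a, {v | (x.2.1 = [] ∧ h a = b :: y.2.1) ∧ v ∈ ⋃ r, N x.1 r + M a r y.1}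
  have hM' : ∀ b x y, IsSemilinearSet (M' b x y) := fun b x y =>
    ((IsSemilinearSet.singleton 0).const_and _).union
      (.iUnion fun a => (IsSemilinearSet.iUnion fun r => (hN _ r).add (hM a r _)).const_and _)
  let nil : Buffer := ⟨[], Nat.zero_le n⟩
  -- The last factor, from `N`, accounts for the erased letters after the final letter with nonempty
  -- image.
  have key (v : List β) : ∀ (s : Buffer) (p q : Q) (x : A),
      (∃ w, s.1 ++ wordHom h w = v ∧ x ∈ pathWeight M w p q) ↔
        ∃ r, ∃ y ∈ pathWeight M' v (p, s) (r, nil), ∃ z ∈ N r q, y + z = x := by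
    induction v with
    | nil =>
      rintro ⟨s, hs⟩ p q x
      simp only [mem_pathWeight_nil, List.append_eq_nil_iff, Prod.mk.injEq, nil]
      constructor
      · rintro ⟨w, ⟨rfl, hw⟩, hx⟩
        exact ⟨p, 0, ⟨⟨rfl, rfl⟩, rfl⟩, x, ⟨w, hw, hx⟩, zero_add x⟩
      · rintro ⟨_, _, ⟨⟨rfl, hs'⟩, rfl⟩, _, ⟨w, hw, hx⟩, rfl⟩
        exact ⟨w, ⟨congrArg Subtype.val hs', hw⟩, by rwa [zero_add]⟩
    | cons b v ih =>
      rintro ⟨s, hs⟩ p q x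
      constructor
      · rintro ⟨w, hw, hx⟩
        cases s with
        | nil =>
          obtain ⟨w₀, a, w₁, t, rfl, h₀, ha, h₁⟩ := wordHom_eq_cons hw
          obtain ⟨r₀, x₀, hx₀, _, hx', rfl⟩ := mem_pathWeight_append.1 hx
          obtain ⟨r₁, x₁, hx₁, x₂, hx₂, rfl⟩ := mem_pathWeight_cons.1 hx'
          have ht : t.length ≤ n := by
            have := hn a
            rw [ha, List.length_cons] at this
            omega
          obtain ⟨r, y, hy, z, hz, rfl⟩ := (ih ⟨t, ht⟩ _ _ _).1 ⟨w₁, h₁, hx₂⟩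
          refine ⟨r, x₀ + x₁ + y, mem_pathWeight_cons.2 ⟨(r₁, ⟨t, ht⟩), x₀ + x₁, ?_, y, hy, rfl⟩,
            z, hz, by simp only [add_assoc]⟩
          exact .inr (Set.mem_iUnion.2 ⟨a, ⟨rfl, ha⟩,
            Set.mem_iUnion.2 ⟨r₀, Set.add_mem_add ⟨w₀, h₀, hx₀⟩ hx₁⟩⟩)
        | cons c t =>
          obtain ⟨rfl, hw'⟩ : c = b ∧ t ++ wordHom h w = v := by simpa using hw
          have ht : t.length ≤ n := by
            rw [List.length_cons] at hs
            omega
          obtain ⟨r, y, hy, z, hz, rfl⟩ := (ih ⟨t, ht⟩ _ _ _).1 ⟨w, hw', hx⟩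
          exact ⟨r, y, mem_pathWeight_cons.2
            ⟨(p, ⟨t, ht⟩), 0, .inl ⟨⟨rfl, rfl⟩, rfl⟩, y, hy, zero_add y⟩, z, hz, rfl⟩
      · rintro ⟨r, _, hy, z, hz, rfl⟩
        obtain ⟨⟨r₁, t, ht⟩, y₁, hy₁, y, hy₂, rfl⟩ := mem_pathWeight_cons.1 hy
        obtain ⟨w, hw, hx⟩ := (ih ⟨t, ht⟩ r₁ q (y + z)).2 ⟨r, y, hy₂, z, hz, rfl⟩
        rcases hy₁ with ⟨⟨hs₁, hpr⟩, rfl⟩ | hy₁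
        · dsimp only at hs₁ hpr hw
          subst hs₁ hpr
          exact ⟨w, by simp [hw], by rwa [zero_add]⟩
        · obtain ⟨a, ⟨hs₁, ha⟩, hy₁⟩ := Set.mem_iUnion.1 hy₁
          obtain ⟨r₀, y₀, ⟨w₀, h₀, hy₀⟩, y₁, hy₃, rfl⟩ := Set.mem_iUnion.1 hy₁
          dsimp only at hs₁ ha hw
          subst hs₁
          refine ⟨w₀ ++ a :: w, ?_, mem_pathWeight_append.2 ⟨r₀, y₀, hy₀, y₁ + (y + z),
            mem_pathWeight_cons.2 ⟨r₁, y₁, hy₃, _, hx, rfl⟩, by simp only [add_assoc]⟩⟩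
          simp only [wordHom] at h₀ hw ⊢
          simp [h₀, ha, hw]
  convert IsSemilinearSet.iUnion fun r =>
    (hL (Q × Buffer) A M' hM' (p₀, nil) (r, nil)).add (hN r q₀) using 1
  ext x
  simp only [Set.mem_iUnion, Set.mem_add]
  constructor
  · rintro ⟨w, hw, hx⟩
    obtain ⟨r, y, hy, z, hz, rfl⟩ := (key _ nil _ _ _).1 ⟨w, rfl, hx⟩
    exact ⟨r, y, ⟨_, hw, hy⟩, z, hz, rfl⟩
  · rintro ⟨r, y, ⟨v, hv, hy⟩, z, hz, rfl⟩
    obtain ⟨w, rfl, hx⟩ := (key v nil _ _ _).2 ⟨r, y, hy, z, hz, rfl⟩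
    exact ⟨w, hv, hx⟩

theorem isFullAFL : RobustlySemilinear.IsFullAFL where
  hom _ _ _ _ h _ hL := hom h hL
  invHom _ _ _ _ h _ hL := invHom h hL
  interRegular _ _ _ _ hL hR := interRegular hL hR
  union _ _ _ _ h₁ h₂ := union h₁ h₂
  concat _ _ _ _ h₁ h₂ := concat h₁ h₂
  star _ _ _ hL := star hL

end RobustlySemilinear

/-! ### Reversal-bounded counters as semilinear conditions -/

/-- A counter with value `v` can perform the given sequence of operations, each consisting of a
test (`true` if the counter is nonzero) and a change. -/
def CounterValid : ℕ → List (Bool × SignType) → Prop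
  | _, [] => True
  | v, (b, d) :: x => b = decide (v ≠ 0) ∧ ∃ v' : ℕ, (v' : ℤ) = v + d ∧ CounterValid v' x

/-- The states of a finite automaton which splits the operations of a counter into stages: the
index of the stage, whether the counter is nonzero in this stage, and the direction in which it
may change. -/
abbrev CounterState (N : ℕ) : Type := Fin (N + 1) × Bool × SignType

/-- The transitions of the stage automaton. Its output at a stage collects the value at the
beginning of the stage plus the increments in the first component, the value at the end of the stage
plus the decrements in the second one. The values at a change of stages are guessed. -/
inductive CounterStep {N : ℕ} : Bool × SignType → CounterState N → CounterState N →
    (Fin (N + 1) → ℕ × ℕ) → Prop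
  | rest (i : Fin (N + 1)) (b : Bool) (s : SignType) : CounterStep (b, 0) (i, b, s) (i, b, s) 0
  | up (i : Fin (N + 1)) : CounterStep (true, 1) (i, true, 1) (i, true, 1) (Pi.single i (1, 0))
  | down (i : Fin (N + 1)) :
      CounterStep (true, -1) (i, true, -1) (i, true, -1) (Pi.single i (0, 1))
  | turn {i j : Fin (N + 1)} {b b' : Bool} {s s' d : SignType} {m n : ℕ} :
      j.val = i.val + 1 → (n : ℤ) = m + d → b = decide (m ≠ 0) → b' = decide (n ≠ 0) →
      CounterStep (b, d) (i, b, s) (j, b', s') (Pi.single i (0, m) + Pi.single j (n, 0))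

/-- The outputs of the stage automaton as a matrix of sets. -/
def counterOutput (N : ℕ) (a : Bool × SignType) (p q : CounterState N) :
    Set (Fin (N + 1) → ℕ × ℕ) :=
  {z | CounterStep a p q z}

/-- The outputs in which the guessed values are correct, for runs ending in the state `q`. -/
def counterBalanced {N : ℕ} (q : CounterState N) : Set (Fin (N + 1) → ℕ × ℕ) :=
  {z | (∀ i < q.1, (z i).1 = (z i).2) ∧ ∃ m : ℕ, (z q.1).1 = (z q.1).2 + m ∧
    q.2.1 = decide (m ≠ 0)}

theorem isSemilinearSet_eq_decide_ne_zero (b : Bool) :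
    IsSemilinearSet {m : ℕ | b = decide (m ≠ 0)} := by
  cases b
  · convert IsSemilinearSet.singleton (0 : ℕ) using 1
    ext m; simp
  · convert (IsSemilinearSet.singleton (0 : ℕ)).compl using 1
    ext m; simp

/-- Only a change of stage has infinitely many outputs; the guessed pairs form the solution set of a
linear equation with zero tests, mapped additively into the outputs. -/
theorem isSemilinearSet_counterOutput (N : ℕ) (a : Bool × SignType) (p q : CounterState N) :
    IsSemilinearSet (counterOutput N a p q) := by
  obtain ⟨b, d⟩ := a
  obtain ⟨i, b₁, s⟩ := p
  obtain ⟨j, b₂, s'⟩ := q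
  let guess : ℕ × ℕ →+ (Fin (N + 1) → ℕ × ℕ) :=
    ((AddMonoidHom.single (fun _ => ℕ × ℕ) i).comp
      ((AddMonoidHom.inr ℕ ℕ).comp (AddMonoidHom.fst ℕ ℕ))) +
    ((AddMonoidHom.single (fun _ => ℕ × ℕ) j).comp
      ((AddMonoidHom.inl ℕ ℕ).comp (AddMonoidHom.snd ℕ ℕ)))
  have hlin : IsSemilinearSet {x : ℕ × ℕ | (0 : ℤ) + x.2 = d + x.1} :=
    isSemilinearSet_setOfPred_eq (0 : ℤ) (d : ℤ)
      ((Nat.castAddMonoidHom ℤ).comp (AddMonoidHom.snd ℕ ℕ))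
      ((Nat.castAddMonoidHom ℤ).comp (AddMonoidHom.fst ℕ ℕ))
  have hturn := (((hlin.inter ((isSemilinearSet_eq_decide_ne_zero b₁).preimage
    (AddMonoidHom.fst ℕ ℕ))).inter ((isSemilinearSet_eq_decide_ne_zero b₂).preimage
      (AddMonoidHom.snd ℕ ℕ))).image guess).const_and (b = b₁ ∧ j.val = i.val + 1)
  convert ((((IsSemilinearSet.singleton 0).const_and
    (d = 0 ∧ b = b₁ ∧ (i, b₁, s) = (j, b₂, s'))).union
    ((IsSemilinearSet.singleton (Pi.single i (1, 0))).const_and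
      (b = true ∧ d = 1 ∧ b₁ = true ∧ s = 1 ∧ (i, b₁, s) = (j, b₂, s')))).union
    ((IsSemilinearSet.singleton (Pi.single i (0, 1))).const_and
      (b = true ∧ d = -1 ∧ b₁ = true ∧ s = -1 ∧ (i, b₁, s) = (j, b₂, s')))).union hturn using 1
  ext z
  constructor
  · intro h
    cases h with
    | rest => exact .inl (.inl (.inl ⟨⟨rfl, rfl, rfl⟩, rfl⟩))
    | up => exact .inl (.inl (.inr ⟨⟨rfl, rfl, rfl, rfl, rfl⟩, rfl⟩))
    | down => exact .inl (.inr ⟨⟨rfl, rfl, rfl, rfl, rfl⟩, rfl⟩)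
    | @turn _ _ _ _ _ _ _ m n hj hn hm hn' =>
      refine .inr ⟨⟨rfl, hj⟩, (m, n), ⟨⟨?_, hm⟩, hn'⟩, rfl⟩
      change (0 : ℤ) + n = d + m
      linarith
  · rintro (((⟨⟨rfl, rfl, h⟩, rfl⟩ | ⟨⟨rfl, rfl, rfl, rfl, h⟩, rfl⟩) |
      ⟨⟨rfl, rfl, rfl, rfl, h⟩, rfl⟩) | ⟨⟨rfl, hj⟩, ⟨m, n⟩, ⟨⟨h, hm⟩, hn⟩, rfl⟩)
    · cases h; exact .rest _ _ _
    · cases h; exact .up _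
    · cases h; exact .down _
    · change (0 : ℤ) + n = d + m at h
      exact .turn hj (show (n : ℤ) = m + d by linarith) hm hn

theorem isSemilinearSet_counterBalanced {N : ℕ} (q : CounterState N) :
    IsSemilinearSet (counterBalanced q) := by
  let E : Fin (N + 1) → (Fin (N + 1) → ℕ × ℕ) →+ ℕ × ℕ := Pi.evalAddMonoidHom (fun _ => ℕ × ℕ)
  have h₁ : IsSemilinearSet {z : Fin (N + 1) → ℕ × ℕ | ∀ i < q.1, (z i).1 = (z i).2} := by
    convert IsSemilinearSet.iInter fun i => (isSemilinearSet_setOfPred_eq 0 0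
      ((AddMonoidHom.fst ℕ ℕ).comp (E i)) ((AddMonoidHom.snd ℕ ℕ).comp (E i))).union
        ((IsSemilinearSet.univ).const_and (¬ i < q.1)) using 1
    ext z
    simp [E, imp_iff_or_not]
  have h₂ := ((isSemilinearSet_setOfPred_eq (M := (Fin (N + 1) → ℕ × ℕ) × ℕ) 0 0
    ((AddMonoidHom.fst ℕ ℕ).comp ((E q.1).comp (AddMonoidHom.fst _ ℕ)))
    ((AddMonoidHom.snd ℕ ℕ).comp ((E q.1).comp (AddMonoidHom.fst _ ℕ)) +
      AddMonoidHom.snd _ ℕ)).inter ((isSemilinearSet_eq_decide_ne_zero q.2.1).preimage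
        (AddMonoidHom.snd _ ℕ))).image (AddMonoidHom.fst _ ℕ)
  convert h₁.inter h₂ using 1
  ext z
  simp [counterBalanced, E]

/-- Stages only move forward and outputs concern the current stage or the next, so later steps
cannot alter a finished stage. -/
theorem counterOutput_support {N : ℕ} {x : List (Bool × SignType)} {p q : CounterState N}
    {z : Fin (N + 1) → ℕ × ℕ} (hz : z ∈ pathWeight (counterOutput N) x p q) :
    p.1 ≤ q.1 ∧ ∀ k < p.1, z k = 0 := by
  induction x generalizing p z with
  | nil =>
    obtain ⟨rfl, rfl⟩ := hz
    exact ⟨le_rfl, fun _ _ => rfl⟩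
  | cons a x ih =>
    obtain ⟨r, z, (hstep : CounterStep _ _ _ _), y, hy, rfl⟩ := mem_pathWeight_cons.1 hz
    obtain ⟨hr, hy⟩ := ih hy
    cases hstep with
    | rest => exact ⟨hr, fun k hk => by simp [hy k hk]⟩
    | up i => exact ⟨hr, fun k hk => by simp [hy k hk, Pi.single_eq_of_ne hk.ne]⟩
    | down i => exact ⟨hr, fun k hk => by simp [hy k hk, Pi.single_eq_of_ne hk.ne]⟩
    | @turn i j _ _ _ _ _ m n hj =>
      have hij : i < j := Fin.lt_def.2 (by omega)
      refine ⟨hij.le.trans hr, fun k (hk : k < i) => ?_⟩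
      simp [hy k (hk.trans hij), Pi.single_eq_of_ne hk.ne, Pi.single_eq_of_ne (hk.trans hij).ne]

/-- In a decreasing nonzero stage the value at its end is positive, either by the guess at the next
turn or by the final test. This excludes reaching zero prematurely. -/
theorem counterOutput_decreasing {N : ℕ} {x : List (Bool × SignType)} {i : Fin (N + 1)}
    {q : CounterState N} {z : Fin (N + 1) → ℕ × ℕ}
    (hz : z ∈ pathWeight (counterOutput N) x (i, true, -1) q) :
    (z i).1 = 0 ∧ (i < q.1 ∧ 1 ≤ (z i).2 ∨ i = q.1 ∧ q.2.1 = true) := by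
  induction x generalizing z with
  | nil =>
    obtain ⟨rfl, rfl⟩ := hz
    exact ⟨rfl, .inr ⟨rfl, rfl⟩⟩
  | cons a x ih =>
    obtain ⟨r, z, (hstep : CounterStep _ _ _ _), y, hy, rfl⟩ := mem_pathWeight_cons.1 hz
    cases hstep with
    | rest => simpa using ih hy
    | down =>
      obtain ⟨h₁, h₂⟩ := ih hy
      refine ⟨by simpa using h₁, h₂.imp (fun h => ⟨h.1, by simp⟩) id⟩
    | @turn _ j _ _ _ _ _ m n hj _ hm =>
      have hij : i < j := Fin.lt_def.2 (by omega)
      obtain ⟨hq, hs⟩ := counterOutput_support hy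
      have hm : m ≠ 0 := by simpa using hm
      refine ⟨?_, .inl ⟨hij.trans_le hq, ?_⟩⟩
      · simp [hs i hij, Pi.single_eq_of_ne hij.ne]
      · simp [hs i hij, Pi.single_eq_of_ne hij.ne]
        omega

/-- Stage `i` receives nothing after the turn, so its balance says precisely that the guessed value
`m` is the true value `v`. -/
theorem turn_mem_counterBalanced_iff {N : ℕ} {i j : Fin (N + 1)} {q : CounterState N}
    {y : Fin (N + 1) → ℕ × ℕ} (hij : i < j) (hjq : j ≤ q.1) (hy : ∀ k < j, y k = 0)
    (v m n : ℕ) :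
    Pi.single i (v, 0) + (Pi.single i (0, m) + Pi.single j (n, 0) + y) ∈ counterBalanced q ↔
      v = m ∧ Pi.single j (n, 0) + y ∈ counterBalanced q := by
  have hi : (Pi.single i (v, 0) + (Pi.single i (0, m) + Pi.single j (n, 0) + y) :
      Fin (N + 1) → ℕ × ℕ) i = (v, m) := by
    simp [hy i hij, Pi.single_eq_of_ne hij.ne]
  have hi' : (Pi.single j (n, 0) + y : Fin (N + 1) → ℕ × ℕ) i = 0 := by
    simp [hy i hij, Pi.single_eq_of_ne hij.ne]
  have hk (k : Fin (N + 1)) (hk : k ≠ i) :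
      (Pi.single i (v, 0) + (Pi.single i (0, m) + Pi.single j (n, 0) + y) :
        Fin (N + 1) → ℕ × ℕ) k = (Pi.single j (n, 0) + y : Fin (N + 1) → ℕ × ℕ) k := by
    simp [Pi.single_eq_of_ne hk]
  have hiq : i < q.1 := hij.trans_le hjq
  constructor
  · rintro ⟨h₁, h₂⟩
    rw [hk _ hiq.ne'] at h₂
    refine ⟨by simpa only [hi] using h₁ i hiq, fun k hkq => ?_, h₂⟩
    by_cases h : k = i
    · rw [h, hi']
      rfl
    · rw [← hk k h]
      exact h₁ k hkq
  · rintro ⟨rfl, h₁, h₂⟩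
    refine ⟨fun k hkq => ?_, by rwa [hk _ hiq.ne']⟩
    by_cases h : k = i
    · rw [h, hi]
    · rw [hk k h]
      exact h₁ k hkq

theorem down_mem_counterBalanced_iff {N : ℕ} (i : Fin (N + 1)) (q : CounterState N)
    (y : Fin (N + 1) → ℕ × ℕ) (v : ℕ) :
    Pi.single i (v + 1, 0) + (Pi.single i (0, 1) + y) ∈ counterBalanced q ↔
      Pi.single i (v, 0) + y ∈ counterBalanced q := by
  have h (k : Fin (N + 1)) :
      (Pi.single i (v + 1, 0) + (Pi.single i (0, 1) + y) : Fin (N + 1) → ℕ × ℕ) k =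
        (Pi.single i (v, 0) + y : Fin (N + 1) → ℕ × ℕ) k + (Pi.single i (1, 1) : Fin (N + 1) → ℕ × ℕ) k := by
    by_cases h : k = i
    · subst h
      ext <;> simp <;> ring
    · simp [Pi.single_eq_of_ne h]
  have h' (k : Fin (N + 1)) : ((Pi.single i (1, 1) : Fin (N + 1) → ℕ × ℕ) k).1 =
      ((Pi.single i (1, 1) : Fin (N + 1) → ℕ × ℕ) k).2 := by
    by_cases h : k = i
    · subst h; simp
    · simp [Pi.single_eq_of_ne h]
  simp only [counterBalanced, Set.mem_ofPred_eq, h, Prod.fst_add, Prod.snd_add, h',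
    add_left_inj, add_right_comm _ (_ : ℕ × ℕ).2 (_ : ℕ)]

theorem up_output {N : ℕ} (i : Fin (N + 1)) (y : Fin (N + 1) → ℕ × ℕ) (v : ℕ) :
    Pi.single i (v, 0) + (Pi.single i (1, 0) + y) = Pi.single i (v + 1, 0) + y := by
  rw [← add_assoc, ← Pi.single_add, Prod.mk_add_mk, add_zero]

/-- Soundness. The summand `(v, 0)` at the current stage stands for the value already reached, and
the balance condition is carried along step by step. -/
theorem counterValid_of_mem_pathWeight {N : ℕ} {x : List (Bool × SignType)}
    {p q : CounterState N} {z : Fin (N + 1) → ℕ × ℕ} {v : ℕ}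
    (hz : z ∈ pathWeight (counterOutput N) x p q) (hv : p.2.1 = decide (v ≠ 0))
    (hq : Pi.single p.1 (v, 0) + z ∈ counterBalanced q) : CounterValid v x := by
  induction x generalizing p z v with
  | nil => trivial
  | cons a x ih =>
    obtain ⟨r, z, (hstep : CounterStep _ _ _ _), y, hy, rfl⟩ := mem_pathWeight_cons.1 hz
    cases hstep with
    | rest i b s => exact ⟨hv, v, by simp, ih hy hv (by simpa using hq)⟩
    | up i =>
      refine ⟨hv, v + 1, by simp, ih hy (by simp) ?_⟩
      rwa [← up_output]
    | down i =>
      obtain ⟨v, rfl⟩ := Nat.exists_eq_succ_of_ne_zero (by simpa using hv : v ≠ 0)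
      have hq' := (down_mem_counterBalanced_iff i q y v).1 hq
      refine ⟨hv, v, by simp, ih hy ?_ hq'⟩
      -- The stage still demands a nonzero counter, so the decremented value must be positive: by
      -- balance it equals the later decrements plus the nonzero end value.
      obtain ⟨h₁, ⟨hi, h₂⟩ | ⟨hi, h₂⟩⟩ := counterOutput_decreasing hy
      · have := hq'.1 i hi
        simp [h₁] at this ⊢
        omega
      · obtain ⟨m, hm, hm'⟩ := hq'.2
        rw [h₂] at hm'
        rw [← hi] at hm
        simp [h₁] at hm hm' ⊢
        omega
    | @turn i j b b' s s' d m n hj hn hm hn' =>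
      have hij : i < j := Fin.lt_def.2 (by omega)
      obtain ⟨hjq, hs⟩ := counterOutput_support hy
      obtain ⟨rfl, hq'⟩ := (turn_mem_counterBalanced_iff hij hjq hs v m n).1 hq
      exact ⟨hv, n, hn, ih hy hn' hq'⟩

/-- Completeness. The left side of `hN` bounds the last stage needed: each reversal costs at most
two turns, and the indicator is `1` when the zero status can still change in the current direction.
-/
theorem exists_mem_pathWeight_of_counterValid {N : ℕ} {x : List (Bool × SignType)} {v : ℕ}
    {s : SignType} {i : Fin (N + 1)} (hs : s ≠ 0) (hx : CounterValid v x)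
    (hN : 2 * reversals s (x.map Prod.snd) + (if v ≠ 0 ↔ s = -1 then 1 else 0) + i.val ≤ N) :
    ∃ q, ∃ z ∈ pathWeight (counterOutput N) x (i, decide (v ≠ 0), s) q,
      Pi.single i (v, 0) + z ∈ counterBalanced q := by
  induction x generalizing v s i with
  | nil =>
    refine ⟨_, 0, ⟨rfl, rfl⟩, fun k hk => ?_, v, by simp, rfl⟩
    have hk : k ≠ i := hk.ne
    simp [Pi.single_eq_of_ne hk]
  | cons a x ih =>
    obtain ⟨b, d⟩ := a
    obtain ⟨rfl, v', hv', hx⟩ := hx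
    -- Entering a new stage with the true values `v` and `v'` as guesses.
    have turn (hd : d ≠ 0) (hlt : i.val < N)
        (hN' : 2 * reversals d (x.map Prod.snd) + (if v' ≠ 0 ↔ d = -1 then 1 else 0) +
          (i.val + 1) ≤ N) :
        ∃ q, ∃ z ∈ pathWeight (counterOutput N) ((decide (v ≠ 0), d) :: x)
          (i, decide (v ≠ 0), s) q, Pi.single i (v, 0) + z ∈ counterBalanced q := by
      let j : Fin (N + 1) := ⟨i.val + 1, by omega⟩
      obtain ⟨q, y, hy, hq⟩ := ih (i := j) hd hx hN'
      obtain ⟨hjq, hsupp⟩ := counterOutput_support hy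
      exact ⟨q, _, mem_pathWeight_cons.2 ⟨_, _, .turn (j := j) rfl hv' rfl rfl, y, hy, rfl⟩,
        (turn_mem_counterBalanced_iff (Fin.lt_def.2 (Nat.lt_succ_self _)) hjq hsupp v v v').2
          ⟨rfl, hq⟩⟩
    by_cases hd : d = 0
    · subst hd
      obtain rfl : v' = v := by simpa using hv'
      obtain ⟨q, y, hy, hq⟩ := ih (i := i) hs hx (by simpa [reversals] using hN)
      exact ⟨q, 0 + y, mem_pathWeight_cons.2 ⟨_, 0, .rest _ _ _, y, hy, rfl⟩, by simpa using hq⟩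
    by_cases hds : d = s
    · subst hds
      simp only [List.map_cons, reversals, or_true, if_true] at hN
      by_cases hb : v ≠ 0 ∧ v' ≠ 0
      · simp only [hb, ne_eq, not_false_eq_true, true_iff] at hN
        obtain ⟨q, y, hy, hq⟩ := ih (i := i) hs hx (by simpa [hb] using hN)
        simp only [hb, ne_eq, not_false_eq_true, decide_true] at hy ⊢
        rcases d with _ | _ | _
        · exact absurd rfl hd
        · obtain rfl : v = v' + 1 := by
            change (v' : ℤ) = v + (-1) at hv'
            omega
          exact ⟨q, _, mem_pathWeight_cons.2 ⟨_, _, .down _, y, hy, rfl⟩,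
            (down_mem_counterBalanced_iff i q y v').2 hq⟩
        · obtain rfl : v' = v + 1 := by
            change (v' : ℤ) = v + 1 at hv'
            omega
          exact ⟨q, _, mem_pathWeight_cons.2 ⟨_, _, .up _, y, hy, rfl⟩, by rwa [up_output]⟩
      -- The counter leaves zero upwards or reaches it downwards. The indicator drops from `1` to
      -- `0`, which pays for the new stage.
      · have h₁ : v ≠ 0 ↔ d = -1 := by
          rcases d with _ | _ | _
          · exact absurd rfl hd
          · change (v' : ℤ) = v + (-1) at hv'
            simp only [SignType.neg_eq_neg_one, iff_true]
            omega
          · change (v' : ℤ) = v + 1 at hv'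
            have : SignType.pos ≠ -1 := by decide
            simp only [this, iff_false]
            omega
        have h₂ : ¬ (v' ≠ 0 ↔ d = -1) := by
          rcases d with _ | _ | _
          · exact absurd rfl hd
          · change (v' : ℤ) = v + (-1) at hv'
            simp only [SignType.neg_eq_neg_one, iff_true]
            omega
          · change (v' : ℤ) = v + 1 at hv'
            have : SignType.pos ≠ -1 := by decide
            simp only [this, iff_false]
            omega
        rw [if_pos h₁] at hN
        refine turn hd (by omega) ?_
        rw [if_neg h₂]
        omega
    -- A reversal releases two units: one for the new stage, one for its indicator.
    · simp only [List.map_cons, reversals, hd, hds, or_self, if_false] at hN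
      refine turn hd (by omega) ?_
      split_ifs at hN ⊢ <;> omega

/-! ### Imposing counter conditions on robust languages -/

namespace RobustlySemilinear

variable {α : Type} [Finite α]

theorem inter_iInter {ι : Type} [Finite ι] {D : ι → Language α}
    (hD : ∀ i, ∀ L ∈ RobustlySemilinear α, L ⊓ D i ∈ RobustlySemilinear α) {L : Language α}
    (hL : L ∈ RobustlySemilinear α) :
    L ⊓ {w | ∀ i, w ∈ D i} ∈ RobustlySemilinear α := by
  suffices ∀ S : Set ι, S.Finite → L ⊓ {w | ∀ i ∈ S, w ∈ D i} ∈ RobustlySemilinear α by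
    simpa using this Set.univ Set.finite_univ
  intro S hS
  induction S, hS using Set.Finite.induction_on with
  | empty =>
    convert hL using 1
    ext w
    exact ⟨fun h => h.1, fun h => ⟨h, fun i hi => hi.elim⟩⟩
  | @insert i S _ _ ih =>
    convert hD i _ ih using 1
    ext w
    constructor
    · exact fun h => ⟨⟨h.1, fun j hj => h.2 j (.inr hj)⟩, h.2 i (.inl rfl)⟩
    · rintro ⟨⟨h₁, h₂⟩, h₃⟩
      refine ⟨h₁, fun j hj => ?_⟩
      rcases hj with rfl | hj
      exacts [h₃, h₂ j hj]

theorem inter_counter (N : ℕ) (op : α → Bool × SignType) {L : Language α}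
    (hL : L ∈ RobustlySemilinear α) :
    L ⊓ {w | ∃ q, ∃ z ∈ counterBalanced q,
      z ∈ pathWeight (counterOutput N) (w.map op) (0, false, 1) q} ∈ RobustlySemilinear α := by
  simp only [pathWeight_map]
  exact inter_pathWeight (fun a => isSemilinearSet_counterOutput N (op a)) _
    isSemilinearSet_counterBalanced hL

end RobustlySemilinear

/-! ### Computations as words over transitions -/

namespace CounterMachine

variable {α : Type} {k : ℕ}

/-- The letters for writing down computations: a state, an input, the results of the zero tests,
the counter changes and the next state. -/
abbrev Transition (M : CounterMachine α k) : Type :=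
  M.State × Option α × (Fin k → Bool) × (Fin k → SignType) × M.State

/-- The transition leads from `p` to `q` and belongs to the machine. -/
def IsTransition (M : CounterMachine α k) (e : M.Transition) (p q : M.State) : Prop :=
  e.1 = p ∧ e.2.2.2.2 = q ∧ (q, e.2.2.2.1) ∈ M.trans p e.2.1 e.2.2.1

/-- The operation of a transition on the counter `i`. -/
def counterOp (M : CounterMachine α k) (i : Fin k) (e : M.Transition) : Bool × SignType :=
  (e.2.2.1 i, e.2.2.2.1 i)

theorem Run.exists_isPath {M : CounterMachine α k} {c c' : M.Config} {w : List α}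
    {ds : List (Fin k → SignType)} (h : M.Run c w ds c') :
    ∃ γ : List M.Transition, wordHom (fun e => e.2.1.toList) γ = w ∧
      γ.map (fun e => e.2.2.2.1) = ds ∧ IsPath M.IsTransition γ c.1 c'.1 ∧
        ∀ i, CounterValid (c.2 i) (γ.map (M.counterOp i)) := by
  induction h with
  | nil c => exact ⟨[], rfl, rfl, rfl, fun i => trivial⟩
  | @cons c c' c'' a d w ds hstep _ ih =>
    obtain ⟨γ, rfl, rfl, hγ, hv⟩ := ih
    exact ⟨(c.1, a, fun i => decide (c.2 i ≠ 0), d, c'.1) :: γ, rfl, rfl,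
      ⟨c'.1, ⟨rfl, rfl, hstep.1⟩, hγ⟩, fun i => ⟨rfl, c'.2 i, hstep.2 i, hv i⟩⟩

theorem exists_run_of_isPath {M : CounterMachine α k} {γ : List M.Transition} {p q : M.State}
    {v : Fin k → ℕ} (hγ : IsPath M.IsTransition γ p q)
    (hv : ∀ i, CounterValid (v i) (γ.map (M.counterOp i))) :
    ∃ v', M.Run (p, v) (wordHom (fun e => e.2.1.toList) γ) (γ.map fun e => e.2.2.2.1)
      (q, v') := by
  induction γ generalizing p v with
  | nil =>
    cases hγ
    exact ⟨v, .nil _⟩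
  | cons e γ ih =>
    obtain ⟨p, a, b, d, r⟩ := e
    obtain ⟨_, ⟨rfl, rfl, htrans⟩, hγ⟩ := hγ
    choose hb v₁ hv₁ hv using hv
    obtain rfl : b = fun i => decide (v i ≠ 0) := funext hb
    obtain ⟨v', hrun⟩ := ih hγ hv
    exact ⟨v', .cons ⟨htrans, hv₁⟩ hrun⟩

end CounterMachine

/-- The accepting computations on words of `L` arise from the preimage of `L` by a regular condition
and one condition per counter. The reversal bound is needed only to see that no accepting
computation is lost. -/
theorem LanguageFamily.IsFullTrio.robustlySemilinear_contains_meet_NCM {𝓛 : LanguageFamily}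
    (hTrio : 𝓛.IsFullTrio) (hSemi : 𝓛.IsSemilinear) :
    RobustlySemilinear.Contains (𝓛.meet NCM) := by
  rintro α _ _ ⟨L, hL, _, ⟨k, l, M, hl, rfl⟩, rfl⟩
  have := M.finite_state
  let label : M.Transition → List α := fun e => e.2.1.toList
  -- The index `2 * l + 1` allows two turns per reversal and one for first leaving zero. The start
  -- state means stage `0`, zero counter, non-decreasing; the initial value `0` needs no output.
  let D : Fin k → Language M.Transition := fun i => {γ | ∃ q, ∃ z ∈ counterBalanced q,
    z ∈ pathWeight (counterOutput (2 * l + 1)) (γ.map (M.counterOp i)) (0, false, 1) q}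
  have h₁ := RobustlySemilinear.invHom label
    (hTrio.robustlySemilinear_contains hSemi α L hL)
  have h₂ := RobustlySemilinear.interRegular h₁
    (isRegular_isPath M.IsTransition M.start M.accept)
  have h₃ := RobustlySemilinear.inter_iInter (D := D)
    (fun i _ => RobustlySemilinear.inter_counter _ (M.counterOp i)) h₂
  convert RobustlySemilinear.hom label h₃ using 1
  ext w
  constructor
  · rintro ⟨hw, ds, c, hc, hrun⟩
    obtain ⟨γ, rfl, rfl, hγ, hv⟩ := hrun.exists_isPath
    refine ⟨γ, ⟨⟨hw, c.1, hc, hγ⟩, fun i => ?_⟩, rfl⟩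
    have hrev := hl _ _ ⟨c, hc, hrun⟩ i
    rw [List.map_map] at hrev
    obtain ⟨q, z, hz, hq⟩ := exists_mem_pathWeight_of_counterValid (N := 2 * l + 1) (s := 1)
      (i := 0) (by decide) (hv i) (by
        rw [List.map_map]
        have : reversals 1 (γ.map (Prod.snd ∘ M.counterOp i)) ≤ l := hrev
        simpa)
    exact ⟨q, z, by simpa [← Prod.zero_eq_mk] using hq, by simpa using hz⟩
  · rintro ⟨γ, ⟨⟨hw, q, hq, hγ⟩, hD⟩, rfl⟩
    have hv (i : Fin k) : CounterValid 0 (γ.map (M.counterOp i)) := by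
      obtain ⟨q, z, hz, hγ⟩ := hD i
      exact counterValid_of_mem_pathWeight hγ (by simp) (by simpa [← Prod.zero_eq_mk] using hz)
    obtain ⟨v', hrun⟩ := CounterMachine.exists_run_of_isPath hγ hv
    exact ⟨hw, _, _, hq, hrun⟩

theorem proposition2 (𝓛 : LanguageFamily) (hTrio : 𝓛.IsFullTrio) (hSemi : 𝓛.IsSemilinear) :
    (𝓛.meet NCM).fullAFLClosure.IsSemilinear := by
  intro α _ L hL
  exact RobustlySemilinear.isSemilinear α L
    (LanguageFamily.fullAFLClosure_least _ _ RobustlySemilinear.isFullAFL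
      (hTrio.robustlySemilinear_contains_meet_NCM hSemi) α L hL)
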